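/- Let $X$ be a finite-dimensional real Euclidean space with its Clifford geometric algebra (in which $vv=v\cdot v$ for vectors $v$), identified as a vector space with the Grassmann algebra of $X$. Let $V,W\subset X$ be subspaces of the same dimension $p$, let $d=\dim(V\cap W)$, and let $(e_1,\dots,e_p)$ and $(f_1,\dots,f_p)$ be associated principal bases of $V$ and $W$ with principal angles $0\le\theta_1\le\dots\le\theta_p\le\frac{\pi}{2}$, i.e. orthonormal bases with $e_i\cdot f_j=\delta_{ij}\cos\theta_i$ for all $i,j$. Put $I_i=0$ for $i\le d$ and $I_i=\frac{e_i\wedge f_i}{\|e_i\wedge f_i\|}$ for $d<i\le p$, $e_i^\perp=I_if_i$ for $d<i\le p$, and let $\Phi_{V,W}=\sum_{i=1}^p\theta_iI_i$ be the corresponding angle bivector. Let $\mathcal{I}^{d+1,p}$ be the set of all multi-indices $\mathbf{i}=(i_1,\dots,i_k)$ with $k\ge 0$ and $d+1\le i_1<\dots<i_k\le p$. For such $\mathbf{i}$ let $I_{\mathbf{i}}=I_{i_1}\cdots I_{i_k}$ (equal to $1$ for $k=0$), and let $W_{\mathbf{i}}$ be the subspace $[I_{\mathbf{i}}F]$ of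 the blade $I_{\mathbf{i}}F$, where $F=f_1f_2\cdots f_p$; here $[v_1\wedge\dots\wedge v_k]=\mathrm{span}(v_1,\dots,v_k)$ for a nonzero blade. Let $\pi_{V,U}=\frac{\mathrm{vol}_p(P_U(S))}{\mathrm{vol}_p(S)}$ be the projection factor of $V$ on a subspace $U$, where $S\subset V$ is any $p$-dimensional parallelotope and $P_U$ is the orthogonal projection onto $U$, and let the asymmetric angle $\Theta_{V,U}\in[0,\frac{\pi}{2}]$ be given by $\cos\Theta_{V,U}=\pi_{V,U}$. Then $$e^{\Phi_{V,W}}=\sum_{\mathbf{i}\in\mathcal{I}^{d+1,p}}\cos\Theta_{V,W_{\mathbf{i}}}\,I_{\mathbf{i}}=\sum_{\mathbf{i}\in\mathcal{I}^{d+1,p}}\pi_{V,W_{\mathbf{i}}}\,I_{\mathbf{i}}.$$ Moreover, each $W_{\mathbf{i}}$ is obtained from $W$ by replacing $f_i$ with $e_i^\perp$ for each $i$ in $\mathbf{i}$, i.e. $W_{\mathbf{i}}$ is spanned by the $f_i$ with $i\notin\mathbf{i}$ and the $e_i^\perp$ with $i\in\mathbf{i}$. -/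

import Mathlib

open scoped RealInnerProductSpace MeasureTheory Nat

namespace BladeAngle

section Clifford

variable (X : Type*) [NormedAddCommGroup X] [InnerProductSpace ℝ X]

/-- The quadratic form `x ↦ x · x = ‖x‖ ^ 2` of a Euclidean space. -/
noncomputable def sqForm : QuadraticForm ℝ X :=
  LinearMap.BilinMap.toQuadraticMap (innerₗ X)

/-- The Clifford geometric algebra of the Euclidean space `X`: vectors square to `x · x`. -/
abbrev Cl : Type _ := CliffordAlgebra (sqForm X)

variable {X}

/-- The inclusion of the vectors into the geometric algebra. -/
noncomputable def vec : X →ₗ[ℝ] Cl X := CliffordAlgebra.ι (sqForm X)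

/-- The canonical identification of the underlying space of the geometric algebra with that of the
Grassmann algebra: a geometric product of orthogonal vectors goes to their exterior product. -/
noncomputable def toExterior : Cl X ≃ₗ[ℝ] ExteriorAlgebra ℝ X :=
  CliffordAlgebra.equivExterior (sqForm X)

/-- The exterior product of multivectors. -/
noncomputable def wedge (M N : Cl X) : Cl X :=
  toExterior.symm (toExterior M * toExterior N)

/-- The exterior product `v₁ ∧ ⋯ ∧ v_k`, as an element of the geometric algebra. -/
noncomputable def blade {k : ℕ} (v : Fin k → X) : Cl X :=
  toExterior.symm (ExteriorAlgebra.ιMulti ℝ k v)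

/-- The grade zero component `⟨M⟩₀` of a multivector. -/
noncomputable def scalarPart (M : Cl X) : ℝ :=
  ExteriorAlgebra.algebraMapInv (toExterior M)

/-- The norm `‖M‖ = √⟨M̃ M⟩₀` of a multivector, where `M̃` is the reversion of `M`. -/
noncomputable def mnorm (M : Cl X) : ℝ :=
  √(scalarPart (CliffordAlgebra.reverse M * M))

/-- For vectors, `v ∧ w = v w - v · w`. -/
theorem wedge_vec (v w : X) :
    wedge (vec v) (vec w) = vec v * vec w - algebraMap ℝ (Cl X) ⟪v, w⟫ := by
  unfold wedge
  rw [LinearEquiv.symm_apply_eq, map_sub]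
  have h1 : toExterior (algebraMap ℝ (Cl X) ⟪v, w⟫) = algebraMap ℝ _ ⟪v, w⟫ :=
    CliffordAlgebra.changeForm_algebraMap CliffordAlgebra.changeForm.associated_neg_proof _
  have h2 : ∀ u : X, toExterior (vec u) = ExteriorAlgebra.ι ℝ u :=
    fun u => CliffordAlgebra.changeForm_ι CliffordAlgebra.changeForm.associated_neg_proof u
  have h3 : toExterior (vec v * vec w) = ExteriorAlgebra.ι ℝ v * ExteriorAlgebra.ι ℝ w -
      algebraMap ℝ _ (QuadraticMap.associated (R := ℝ) (-(sqForm X)) v w) :=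
    CliffordAlgebra.changeForm_ι_mul_ι CliffordAlgebra.changeForm.associated_neg_proof v w
  have h4 : QuadraticMap.associated (R := ℝ) (-(sqForm X)) v w = -⟪v, w⟫ := by
    rw [map_neg, LinearMap.neg_apply, LinearMap.neg_apply]
    have : QuadraticMap.associated (R := ℝ) (sqForm X) = innerₗ X :=
      QuadraticMap.associated_left_inverse ℝ (fun x y => real_inner_comm y x)
    rw [this]; rfl
  rw [h1, h2, h2, h3, h4, map_neg]
  abel

/-- The subspace `[B]` of a blade `B`: it is `span (v₁, …, v_k)` if `B = v₁ ∧ ⋯ ∧ v_k ≠ 0`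
(any such decomposition gives the same span), and `[0] = {0}`. -/
noncomputable def bladeSpace (B : Cl X) : Submodule ℝ X :=
  sSup {U | B ≠ 0 ∧ ∃ (k : ℕ) (v : Fin k → X), B = blade v ∧ U = Submodule.span ℝ (Set.range v)}

/-- The exterior product of linearly independent vectors is nonzero. -/
theorem blade_ne_zero {k : ℕ} {v : Fin k → X} (hv : LinearIndependent ℝ v) : blade v ≠ 0 := by
  have h := (exteriorPower.ιMulti_family_linearIndependent_field (n := k) hv).ne_zero
    (Set.powersetCard.ofFinEmbEquiv (RelEmbedding.refl _))
  intro h0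
  apply h
  rw [blade, LinearEquiv.map_eq_zero_iff] at h0
  apply Subtype.ext
  rw [exteriorPower.ιMulti_family_apply_coe, ExteriorAlgebra.ιMulti_family,
    Equiv.symm_apply_apply]
  exact h0

/-- A blade vanishes under exterior multiplication exactly by the vectors of its subspace. -/
theorem blade_cons_eq_zero_iff {k : ℕ} {v : Fin k → X} (hv : blade v ≠ 0) (x : X) :
    wedge (vec x) (blade v) = 0 ↔ x ∈ Submodule.span ℝ (Set.range v) := by
  have hli : LinearIndependent ℝ v := by
    by_contra hc
    exact hv (by rw [blade, AlternatingMap.map_linearDependent _ _ hc, map_zero])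
  have hx : wedge (vec x) (blade v) = blade (Fin.cons x v : Fin (k + 1) → X) := by
    have h2 : toExterior (vec x) = ExteriorAlgebra.ι ℝ x :=
      CliffordAlgebra.changeForm_ι CliffordAlgebra.changeForm.associated_neg_proof x
    simp only [wedge, blade, LinearEquiv.apply_symm_apply, h2, ExteriorAlgebra.ιMulti_succ_apply]
    rfl
  rw [hx]
  constructor
  · intro h0
    by_contra hc
    exact blade_ne_zero (linearIndependent_finCons.2 ⟨hli, hc⟩) h0
  · intro hmem
    rw [blade, AlternatingMap.map_linearDependent, map_zero]
    intro hc
    exact (linearIndependent_finCons.1 hc).2 hmem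

/-- The subspace of a nonzero blade is the span of the vectors in any decomposition of it. -/
theorem bladeSpace_blade {k : ℕ} {v : Fin k → X} (hv : blade v ≠ 0) :
    bladeSpace (blade v) = Submodule.span ℝ (Set.range v) := by
  apply le_antisymm
  · apply sSup_le
    rintro U ⟨-, l, w, hw, rfl⟩
    intro x hx
    rw [← blade_cons_eq_zero_iff (hw ▸ hv)] at hx
    rwa [← blade_cons_eq_zero_iff hv, hw]
  · exact le_sSup ⟨hv, k, v, rfl, rfl⟩

end Clifford

section Exponential

variable {X : Type*} [NormedAddCommGroup X] [InnerProductSpace ℝ X] [FiniteDimensional ℝ X]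

instance finite_Cl : Module.Finite ℝ (Cl X) :=
  Module.Finite.of_basis
    ((Module.finBasis ℝ X).ExteriorAlgebra.map (toExterior (X := X)).symm)

/-- The geometric algebra carries its unique Hausdorff vector space topology. -/
noncomputable instance topology_Cl : TopologicalSpace (Cl X) := moduleTopology ℝ (Cl X)

instance isModuleTopology_Cl : IsModuleTopology ℝ (Cl X) := ⟨rfl⟩

instance isTopologicalRing_Cl : IsTopologicalRing (Cl X) :=
  IsModuleTopology.isTopologicalRing ℝ (Cl X)

/-- The exponential `∑ Mⁿ / n!` in the geometric algebra. -/
noncomputable def mexp (M : Cl X) : Cl X := NormedSpace.exp M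

end Exponential

section Volume

variable {X : Type*} [NormedAddCommGroup X] [InnerProductSpace ℝ X] [FiniteDimensional ℝ X]
  [MeasurableSpace X] [BorelSpace X]

/-- The factor `vol_p (P_W S) / vol_p S`, where `p = dim V`, `P_W` is the orthogonal projection
onto `W` and `vol_p` is the `p`-dimensional volume. -/
noncomputable def volumeRatio (V W : Submodule ℝ X) (S : Set X) : ℝ :=
  (μHE[Module.finrank ℝ V] (W.starProjection '' S)).toReal /
    (μHE[Module.finrank ℝ V] S).toReal

/-- The projection factor `π_{V,W}` of `V` on `W`: the factor by which the orthogonal projection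
onto `W` changes the volume of a `p`-dimensional parallelotope in `V`, where `p = dim V`.
It is computed on a unit cube; the next theorem says that every parallelotope gives the same. -/
noncomputable def projectionFactor (V W : Submodule ℝ X) : ℝ :=
  volumeRatio V W (parallelepiped fun i => (stdOrthonormalBasis ℝ V i : X))

/-- The projection factor does not depend on the parallelotope. -/
theorem projectionFactor_eq_volumeRatio (V W : Submodule ℝ X)
    (b : Module.Basis (Fin (Module.finrank ℝ V)) ℝ V) :
    projectionFactor V W = volumeRatio V W (parallelepiped fun i => (b i : X)) := by
  have key : ∀ c : Module.Basis (Fin (Module.finrank ℝ V)) ℝ V,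
      volumeRatio V W (parallelepiped fun i => (c i : X)) =
        (W.starProjection.toLinearMap ∘ₗ V.subtype).normDet := by
    intro c
    have e1 : (parallelepiped fun i => (c i : X)) = V.subtype '' parallelepiped c := by
      rw [image_parallelepiped]; rfl
    have e2 : W.starProjection '' (parallelepiped fun i => (c i : X)) =
        (W.starProjection.toLinearMap ∘ₗ V.subtype) '' parallelepiped c := by
      rw [e1, Set.image_image]; rfl
    have e3 : (MeasureTheory.volume (parallelepiped c)).toReal ≠ 0 := by
      refine (ENNReal.toReal_pos ?_ ?_).ne'
      · have := (MeasureTheory.Measure.measure_pos_of_nonempty_interior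
          MeasureTheory.volume c.parallelepiped.interior_nonempty).ne'
        simpa using this
      · exact (c.parallelepiped.isCompact.measure_lt_top (μ := MeasureTheory.volume)).ne
    unfold volumeRatio
    rw [e2, e1, LinearMap.euclideanHausdorffMeasure_image_eq_normDet_mul_volume,
      LinearMap.euclideanHausdorffMeasure_image_eq_normDet_mul_volume, LinearMap.normDet_subtype,
      ENNReal.toReal_mul, ENNReal.toReal_mul, ENNReal.ofReal_one, ENNReal.toReal_one, one_mul,
      ENNReal.toReal_ofReal (LinearMap.normDet_nonneg _), mul_div_assoc, div_self e3, mul_one]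
  rw [key b, ← key (stdOrthonormalBasis ℝ V).toBasis]
  simp [projectionFactor]

/-- The asymmetric angle `Θ_{V,W} ∈ [0, π/2]` of `V` with `W`, given by
`cos Θ_{V,W} = π_{V,W}`. -/
noncomputable def asymmetricAngle (V W : Submodule ℝ X) : ℝ :=
  Real.arccos (projectionFactor V W)

end Volume

section Principal

variable {X : Type*} [NormedAddCommGroup X] [InnerProductSpace ℝ X]

/-- The orthonormal bases `(e₁, …, e_p)` of `V` and `(f₁, …, f_p)` of `W` are associated principal
bases, with principal angles `0 ≤ θ₁ ≤ ⋯ ≤ θ_p ≤ π/2`. -/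
structure IsAssociatedPrincipal {V W : Submodule ℝ X} {p : ℕ}
    (e : OrthonormalBasis (Fin p) ℝ V) (f : OrthonormalBasis (Fin p) ℝ W) (θ : Fin p → ℝ) :
    Prop where
  monotone : Monotone θ
  mem_Icc : ∀ i, θ i ∈ Set.Icc 0 (Real.pi / 2)
  inner_eq : ∀ i j, ⟪(e i : X), (f j : X)⟫ = if i = j then Real.cos (θ i) else 0

variable {V W : Submodule ℝ X} {p : ℕ}
  (e : OrthonormalBasis (Fin p) ℝ V) (f : OrthonormalBasis (Fin p) ℝ W)

/-- The principal bivectors `I_i` (oriented from `V` to `W`): `I_i` is the normalization of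
`e_i ∧ f_i`, except that it is zero for the first `d = dim (V ∩ W)` indices.
Indices of type `Fin p` start at zero. -/
noncomputable def principalBivector (i : Fin p) : Cl X :=
  if (i : ℕ) < Module.finrank ℝ (V ⊓ W : Submodule ℝ X) then 0
  else (mnorm (wedge (vec (e i : X)) (vec (f i : X))))⁻¹ • wedge (vec (e i : X)) (vec (f i : X))

/-- The orthoprincipal vectors `e_i^⊥ = I_i f_i`, as elements of the geometric algebra. -/
noncomputable def orthoprincipal (i : Fin p) : Cl X :=
  principalBivector e f i * vec (f i : X)

/-- The angle bivector `Φ_{V,W} = ∑ θ_i I_i`. -/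
noncomputable def angleBivector (θ : Fin p → ℝ) : Cl X :=
  ∑ i, θ i • principalBivector e f i

/-- The multi-indices `i₁ < ⋯ < i_k` (for any `k ≥ 0`) of indices in the range `d + 1, …, p`
(which is `d, …, p - 1` in `Fin p`), given as finite sets. -/
def multiIndices (d p : ℕ) : Finset (Finset (Fin p)) :=
  Finset.univ.filter fun s => ∀ i ∈ s, d ≤ (i : ℕ)

/-- `I_s = I_{i₁} ⋯ I_{i_k}` for a multi-index `s` with elements `i₁ < ⋯ < i_k`;
it is `1` for the empty multi-index. -/
noncomputable def bivectorProd (s : Finset (Fin p)) : Cl X :=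
  (s.sort.map (principalBivector e f)).prod

/-- The geometric product `F = f₁ f₂ ⋯ f_p`. -/
noncomputable def basisProd : Cl X := (List.ofFn fun i => vec (f i : X)).prod

/-- The coordinate subspaces `W_s = [F_s]`, where `F_s = I_s F`. -/
noncomputable def coordSubspace (s : Finset (Fin p)) : Submodule ℝ X :=
  bladeSpace (bivectorProd e f s * basisProd f)

end Principal

end BladeAngle

/-! When `θ i ≠ 0`, write `e i = cos (θ i) • f i + sin (θ i) • u i` with `u i` (`orthoVector`) a
unit vector orthogonal to `f i`. Then `e i ∧ f i = sin (θ i) • u i f i`, so the principal bivector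
is `I_i = u_i f_i`; hence `I_i² = -1` and `I_i f_i = u_i`, which is `e_i^⊥`. The principal planes
are mutually orthogonal, so the `I_i` commute, and the exponential of the angle bivector is the
product of the factors `cos θ_i + I_i sin θ_i`. Expanding it (`mexp_sum_smul`) gives `I_s` the
coefficient `∏_{i ∈ s} sin θ_i · ∏_{i ∉ s} cos θ_i`.

On the geometric side, `I_s F` is `F` with `f_i` replaced by `u_i` for `i ∈ s`
(`bivectorProd_mul_basisProd`). The new factors are orthonormal, so this product is a blade and
`W_s` is their span. Their inner products with the `e_i` form a diagonal matrix with entries `sin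
θ_i` or `cos θ_i`, so the projection factor is the product of these entries, the same coefficient
(`projectionFactor_coordSubspace`).

The indices excluded from multi-indices are exactly those with angle zero (`lt_finrank_inf_iff`);
they contribute only factors `cos 0 = 1`. -/

namespace BladeAngle

/-! ### Products of orthogonal vectors in the geometric algebra -/

section OrthogonalProducts

variable {X : Type*} [NormedAddCommGroup X] [InnerProductSpace ℝ X]

theorem vec_mul_self (v : X) : vec v * vec v = algebraMap ℝ (Cl X) ⟪v, v⟫ :=
  CliffordAlgebra.ι_sq_scalar (sqForm X) v

theorem vec_mul_vec_add_swap (v w : X) :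
    vec v * vec w + vec w * vec v = algebraMap ℝ (Cl X) (2 * ⟪v, w⟫) := by
  have h := vec_mul_self (v + w)
  rw [map_add, add_mul, mul_add, mul_add, vec_mul_self, vec_mul_self, inner_add_add_self,
    real_inner_comm v w, map_add, map_add, map_add] at h
  rw [two_mul, map_add]
  have h2 : ∀ a b c d e : Cl X, a + b + (c + d) = a + e + e + d → b + c = e + e := by
    intro a b c d e h
    have h' : a + (b + c) + d = a + (e + e) + d := by
      simpa only [add_assoc] using h
    exact add_left_cancel (add_right_cancel h')
  exact h2 _ _ _ _ _ h

theorem vec_mul_vec_of_orthogonal {v w : X} (h : ⟪v, w⟫ = 0) :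
    vec v * vec w = -(vec w * vec v) := by
  rw [eq_neg_iff_add_eq_zero, vec_mul_vec_add_swap, h, mul_zero, map_zero]

/-- The product of two vectors commutes with every vector orthogonal to both. -/
theorem commute_vec_mul_vec {u f w : X} (hu : ⟪u, w⟫ = 0) (hf : ⟪f, w⟫ = 0) :
    Commute (vec u * vec f) (vec w) := by
  rw [commute_iff_eq, mul_assoc, vec_mul_vec_of_orthogonal hf, mul_neg, ← mul_assoc,
    vec_mul_vec_of_orthogonal hu, neg_mul, neg_neg, mul_assoc]

/-- This is `v M = v ∧ M + v ⌟ M`. Passing from `sqForm X` to the zero form changes the form by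
`-sqForm X`, which turns the minus sign of the general formula into a plus. -/
theorem toExterior_vec_mul (v : X) (M : Cl X) :
    toExterior (vec v * M) = ExteriorAlgebra.ι ℝ v * toExterior M +
      CliffordAlgebra.contractLeft (Q := (0 : QuadraticForm ℝ X)) (innerₗ X v) (toExterior M) := by
  have h : toExterior (vec v * M) = ExteriorAlgebra.ι ℝ v * toExterior M -
      CliffordAlgebra.contractLeft (Q := (0 : QuadraticForm ℝ X))
        (QuadraticMap.associated (R := ℝ) (-(sqForm X)) v) (toExterior M) :=
    CliffordAlgebra.changeForm_ι_mul CliffordAlgebra.changeForm.associated_neg_proof v M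
  have h4 : QuadraticMap.associated (R := ℝ) (-(sqForm X)) v = -innerₗ X v := by
    rw [map_neg, LinearMap.neg_apply]
    have : QuadraticMap.associated (R := ℝ) (sqForm X) = innerₗ X :=
      QuadraticMap.associated_left_inverse ℝ (fun x y => real_inner_comm y x)
    rw [this]
  rw [h4, map_neg, LinearMap.neg_apply, sub_neg_eq_add] at h
  exact h

/-- Contraction is an antiderivation, so each term it produces contains some factor `d (v i)`. -/
theorem contractLeft_ιMulti_eq_zero {k : ℕ} (d : Module.Dual ℝ X) (v : Fin k → X)
    (h : ∀ i, d (v i) = 0) :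
    CliffordAlgebra.contractLeft (Q := (0 : QuadraticForm ℝ X)) d
      (ExteriorAlgebra.ιMulti ℝ k v) = 0 := by
  induction k with
  | zero =>
    rw [ExteriorAlgebra.ιMulti_zero_apply]
    exact CliffordAlgebra.contractLeft_one _ d
  | succ k ih =>
    rw [ExteriorAlgebra.ιMulti_succ_apply]
    refine (CliffordAlgebra.contractLeft_ι_mul d _ _).trans ?_
    rw [h 0, zero_smul, ih (Matrix.vecTail v) fun i => h i.succ, mul_zero, sub_zero]

/-- The geometric product of pairwise orthogonal vectors is their exterior product. -/
theorem prod_vec_eq_blade {k : ℕ} (v : Fin k → X) (h : Pairwise fun i j => ⟪v i, v j⟫ = 0) :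
    (List.ofFn fun i => vec (v i)).prod = blade v := by
  rw [blade, LinearEquiv.eq_symm_apply]
  induction k with
  | zero =>
    rw [List.ofFn_zero, List.prod_nil, ExteriorAlgebra.ιMulti_zero_apply]
    exact CliffordAlgebra.changeForm_one CliffordAlgebra.changeForm.associated_neg_proof
  | succ k ih =>
    rw [List.ofFn_succ, List.prod_cons, toExterior_vec_mul,
      ih (fun i => v i.succ) fun i j hij => h (by simpa using hij),
      contractLeft_ιMulti_eq_zero _ _ fun i => h (Fin.succ_ne_zero i).symm, add_zero,
      ExteriorAlgebra.ιMulti_succ_apply]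
    rfl

theorem scalarPart_algebraMap (r : ℝ) : scalarPart (algebraMap ℝ (Cl X) r) = r := by
  have h1 : toExterior (algebraMap ℝ (Cl X) r) = algebraMap ℝ _ r :=
    CliffordAlgebra.changeForm_algebraMap CliffordAlgebra.changeForm.associated_neg_proof _
  rw [scalarPart, h1]
  exact ExteriorAlgebra.algebraMap_leftInverse X r

theorem mnorm_smul_vec_mul_vec {u f : X} (hu : ‖u‖ = 1) (hf : ‖f‖ = 1) {c : ℝ} (hc : 0 ≤ c) :
    mnorm (c • (vec u * vec f)) = c := by
  have hr : ∀ w : X, CliffordAlgebra.reverse (vec w) = vec w := CliffordAlgebra.reverse_ι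
  have hu' : vec u * vec u = 1 := by rw [vec_mul_self, real_inner_self_eq_norm_sq, hu]; simp
  have hf' : vec f * vec f = 1 := by rw [vec_mul_self, real_inner_self_eq_norm_sq, hf]; simp
  have h : CliffordAlgebra.reverse (c • (vec u * vec f)) * (c • (vec u * vec f)) =
      algebraMap ℝ (Cl X) (c ^ 2) := by
    rw [map_smul, CliffordAlgebra.reverse.map_mul, hr, hr, smul_mul_smul_comm, mul_assoc,
      ← mul_assoc (vec u), hu', one_mul, hf', ← Algebra.algebraMap_eq_smul_one, sq]
  rw [mnorm, h, scalarPart_algebraMap, Real.sqrt_sq hc]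

/-- The exterior product of `c f + s u` with `f` is `s u f` for orthogonal `u` and `f`. -/
theorem wedge_add_smul {u f : X} (huf : ⟪u, f⟫ = 0) (c s : ℝ) :
    wedge (vec (c • f + s • u)) (vec f) = s • (vec u * vec f) := by
  rw [wedge_vec, map_add, map_smul, map_smul, add_mul, smul_mul_assoc, smul_mul_assoc,
    vec_mul_self, inner_add_left, inner_smul_left, inner_smul_left, huf]
  simp [Algebra.smul_def]

end OrthogonalProducts

/-- Left multiplication by an element commuting with all earlier factors acts on one factor. -/
theorem mul_prod_ofFn_eq_update {R : Type*} [Monoid R] {n : ℕ} (x : Fin n → R) (a : Fin n) (c : R)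
    (h : ∀ j < a, Commute c (x j)) :
    c * (List.ofFn x).prod = (List.ofFn (Function.update x a (c * x a))).prod := by
  induction n with
  | zero => exact a.elim0
  | succ n ih =>
    rw [List.ofFn_succ, List.ofFn_succ, List.prod_cons, List.prod_cons, ← mul_assoc]
    cases a using Fin.cases with
    | zero =>
      rw [Function.update_self]
      congr 4
    | succ b =>
      rw [(h 0 (Fin.succ_pos b)).eq, mul_assoc,
        ih (fun i => x i.succ) b fun j hj => h j.succ (Fin.succ_lt_succ_iff.2 hj),
        Function.update_of_ne (Fin.succ_ne_zero b).symm]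
      congr 3
      ext i
      by_cases hi : i = b
      · subst hi; simp
      · rw [Function.update_of_ne hi, Function.update_of_ne (by simpa using hi)]

/-! ### Exponentials of commuting imaginary units -/

section Exponential

variable {X : Type*} [NormedAddCommGroup X] [InnerProductSpace ℝ X] [FiniteDimensional ℝ X]

/-- Euler's formula in `ℂ`, transported along the algebra map that sends `Complex.I` to `J`. -/
theorem exp_smul_of_mul_self_eq_neg_one {A : Type*} [NormedRing A] [NormedAlgebra ℝ A]
    [NormedAlgebra ℚ A] [CompleteSpace A] {J : A} (hJ : J * J = -1) (t : ℝ) :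
    NormedSpace.exp (t • J) = Real.cos t • 1 + Real.sin t • J := by
  have hc : Continuous (Complex.lift ⟨J, hJ⟩ : ℂ →ₐ[ℝ] A) :=
    LinearMap.continuous_of_finiteDimensional (Complex.lift ⟨J, hJ⟩ : ℂ →ₐ[ℝ] A).toLinearMap
  have h := NormedSpace.map_exp (Complex.lift ⟨J, hJ⟩ : ℂ →ₐ[ℝ] A) hc (t * Complex.I)
  rw [← Complex.exp_eq_exp_ℂ] at h
  simp only [Complex.lift_apply, Complex.liftAux_apply, Complex.exp_ofReal_mul_I_re,
    Complex.exp_ofReal_mul_I_im] at h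
  simpa [Algebra.algebraMap_eq_smul_one] using h.symm

/-- The exponential of a sum of commuting imaginary units with real coefficients, as the expansion
of the product of the exponentials of the summands. -/
theorem exp_sum_smul {A : Type*} [NormedRing A] [NormedAlgebra ℝ A]
    [NormedAlgebra ℚ A] [CompleteSpace A] {ι : Type*} [LinearOrder ι] (J : ι → A) (θ : ι → ℝ)
    (t : Finset ι) (hJ : ∀ i ∈ t, J i * J i = -1)
    (hc : ∀ i ∈ t, ∀ j ∈ t, Commute (J i) (J j)) :
    NormedSpace.exp (∑ i ∈ t, θ i • J i) = ∑ s ∈ t.powerset,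
      (∏ i ∈ t, if i ∈ s then Real.sin (θ i) else Real.cos (θ i)) • (s.sort.map J).prod := by
  -- Adding a new minimum puts its factor at the head of the sorted product, which matches left
  -- multiplication by `exp (θ a • J a)`.
  induction t using Finset.induction_on_min with
  | empty => simp [NormedSpace.exp_zero]
  | insert a t ha ih =>
    have hat : a ∉ t := fun h => lt_irrefl _ (ha a h)
    have hcomm : Commute (θ a • J a) (∑ i ∈ t, θ i • J i) :=
      Commute.sum_right _ _ _ fun i hi => ((hc a (by simp) i (by simp [hi])).smul_left _).smul_right _
    rw [Finset.sum_insert hat, NormedSpace.exp_add_of_commute hcomm,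
      exp_smul_of_mul_self_eq_neg_one (hJ a (by simp)),
      ih (fun i hi => hJ i (by simp [hi])) fun i hi j hj => hc i (by simp [hi]) j (by simp [hj]),
      Finset.sum_powerset_insert hat, add_mul, Finset.mul_sum, Finset.mul_sum]
    congr 1
    · refine Finset.sum_congr rfl fun s hs => ?_
      have has : a ∉ s := fun h => hat (Finset.mem_powerset.1 hs h)
      rw [Finset.prod_insert hat, if_neg has, smul_mul_smul_comm, one_mul]
    · refine Finset.sum_congr rfl fun s hs => ?_
      have hst := Finset.mem_powerset.1 hs
      have has : a ∉ s := fun h => hat (hst h)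
      rw [Finset.prod_insert hat, if_pos (by simp), smul_mul_smul_comm,
        Finset.sort_insert (r := (· ≤ ·)) (fun b hb => (ha b (hst hb)).le) has, List.map_cons, List.prod_cons]
      congr 2
      refine Finset.prod_congr rfl fun i hi => ?_
      have : i ≠ a := fun h => hat (h ▸ hi)
      simp [this]

/-- The exponential of the geometric algebra, computed in a normed algebra containing it. -/
theorem mexp_eq_leftInverse_exp {A : Type*} [NormedRing A] [NormedAlgebra ℝ A]
    [NormedAlgebra ℚ A] [FiniteDimensional ℝ A] [CompleteSpace A] (L : Cl X →ₐ[ℝ] A)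
    (r : A →ₗ[ℝ] Cl X) (hr : ∀ M, r (L M) = M) (M : Cl X) :
    mexp M = r (NormedSpace.exp (L M)) := by
  have hrc : Continuous r := LinearMap.continuous_of_finiteDimensional r
  have hLc : Continuous L := IsModuleTopology.continuous_of_linearMap L.toLinearMap
  -- The Hausdorff property makes the sum of the exponential series unique.
  have : T2Space (Cl X) :=
    T2Space.of_injective_continuous (Function.LeftInverse.injective hr) hLc
  have h := (NormedSpace.exp_series_hasSum_exp' (𝕂 := ℝ) (L M)).map r hrc
  rw [mexp, NormedSpace.exp_eq_tsum ℝ]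
  refine HasSum.tsum_eq ?_
  convert h using 2 with n
  simp only [Function.comp, map_smul, ← map_pow, hr]

/-- The expansion of the exponential of a sum of commuting imaginary units, in terms of a normed
algebra containing the geometric algebra. -/
theorem mexp_sum_smul_of_injective {A : Type*} [NormedRing A] [NormedAlgebra ℝ A]
    [FiniteDimensional ℝ A] (L : Cl X →ₐ[ℝ] A)
    (hL : Function.Injective L) {ι : Type*} [LinearOrder ι] (J : ι → Cl X) (θ : ι → ℝ)
    (t : Finset ι) (hJ : ∀ i ∈ t, J i * J i = -1)
    (hc : ∀ i ∈ t, ∀ j ∈ t, Commute (J i) (J j)) :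
    mexp (∑ i ∈ t, θ i • J i) = ∑ s ∈ t.powerset,
      (∏ i ∈ t, if i ∈ s then Real.sin (θ i) else Real.cos (θ i)) • (s.sort.map J).prod := by
  let _ : NormedAlgebra ℚ A := NormedAlgebra.restrictScalars ℚ ℝ A
  have : CompleteSpace A := FiniteDimensional.complete ℝ A
  obtain ⟨r, hr⟩ := L.toLinearMap.exists_leftInverse_of_injective (LinearMap.ker_eq_bot.2 hL)
  have hr' : ∀ M, r (L M) = M := fun M => LinearMap.congr_fun hr M
  rw [mexp_eq_leftInverse_exp L r hr', map_sum]
  simp only [map_smul]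
  rw [exp_sum_smul (fun i => L (J i)) θ t
    (fun i hi => by rw [← map_mul, hJ i hi, map_neg, map_one])
    fun i hi j hj => (hc i hi j hj).map L, map_sum]
  refine Finset.sum_congr rfl fun s _ => ?_
  rw [map_smul, ← hr' (List.map J _).prod, map_list_prod L, List.map_map]
  rfl

open scoped Matrix.Norms.Operator in
/-- The expansion of the exponential of a sum of commuting imaginary units in the geometric
algebra. -/
theorem mexp_sum_smul {ι : Type*} [LinearOrder ι] (J : ι → Cl X) (θ : ι → ℝ)
    (t : Finset ι) (hJ : ∀ i ∈ t, J i * J i = -1)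
    (hc : ∀ i ∈ t, ∀ j ∈ t, Commute (J i) (J j)) :
    mexp (∑ i ∈ t, θ i • J i) = ∑ s ∈ t.powerset,
      (∏ i ∈ t, if i ∈ s then Real.sin (θ i) else Real.cos (θ i)) • (s.sort.map J).prod :=
  -- The left regular representation embeds the geometric algebra in a matrix algebra, where the
  -- operator norm is submultiplicative.
  mexp_sum_smul_of_injective (Algebra.leftMulMatrix (Module.finBasis ℝ (Cl X)))
    (Algebra.leftMulMatrix_injective _) J θ t hJ hc

end Exponential

/-! ### Projection factors as Gram determinants -/

section ProjectionFactor

variable {X : Type*} [NormedAddCommGroup X] [InnerProductSpace ℝ X] [FiniteDimensional ℝ X]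
  [MeasurableSpace X] [BorelSpace X]

theorem projectionFactor_eq_normDet (V U : Submodule ℝ X) :
    projectionFactor V U = (U.starProjection.toLinearMap ∘ₗ V.subtype).normDet := by
  let c := (stdOrthonormalBasis ℝ V).toBasis
  have e1 : (parallelepiped fun i => (c i : X)) = V.subtype '' parallelepiped c := by
    rw [image_parallelepiped]; rfl
  have e2 : U.starProjection '' (parallelepiped fun i => (c i : X)) =
      (U.starProjection.toLinearMap ∘ₗ V.subtype) '' parallelepiped c := by
    rw [e1, Set.image_image]; rfl
  have e3 : (MeasureTheory.volume (parallelepiped c)).toReal ≠ 0 := by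
    refine (ENNReal.toReal_pos ?_ ?_).ne'
    · have := (MeasureTheory.Measure.measure_pos_of_nonempty_interior
        MeasureTheory.volume c.parallelepiped.interior_nonempty).ne'
      simpa using this
    · exact (c.parallelepiped.isCompact.measure_lt_top (μ := MeasureTheory.volume)).ne
  rw [projectionFactor_eq_volumeRatio V U c]
  unfold volumeRatio
  rw [e2, e1, LinearMap.euclideanHausdorffMeasure_image_eq_normDet_mul_volume,
    LinearMap.euclideanHausdorffMeasure_image_eq_normDet_mul_volume, LinearMap.normDet_subtype,
    ENNReal.toReal_mul, ENNReal.toReal_mul, ENNReal.ofReal_one, ENNReal.toReal_one, one_mul,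
    ENNReal.toReal_ofReal (LinearMap.normDet_nonneg _), mul_div_assoc, div_self e3, mul_one]

/-- If an orthonormal basis of `V` and an orthonormal family `g` have a diagonal matrix of inner
products, the projection factor on the span of `g` is the product of the diagonal entries. -/
theorem projectionFactor_span_of_inner_eq_diagonal {V : Submodule ℝ X} {ι : Type*} [Fintype ι]
    [DecidableEq ι] (e : OrthonormalBasis ι ℝ V) {g : ι → X} (hg : Orthonormal ℝ g) {c : ι → ℝ}
    (hc : ∀ i, 0 ≤ c i) (heg : ∀ i j, ⟪(e i : X), g j⟫ = if i = j then c i else 0) :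
    projectionFactor V (Submodule.span ℝ (Set.range g)) = ∏ i, c i := by
  have hgi := orthonormal_iff_ite.1 hg
  have hproj : ∀ i, (Submodule.span ℝ (Set.range g)).starProjection (e i : X) = c i • g i := by
    intro i
    refine Submodule.eq_starProjection_of_mem_orthogonal
      (Submodule.smul_mem _ _ (Submodule.subset_span ⟨i, rfl⟩)) ?_
    rw [Submodule.mem_orthogonal]
    intro x hx
    induction hx using Submodule.span_induction with
    | mem x hx =>
      obtain ⟨j, rfl⟩ := hx
      rw [inner_sub_right, real_inner_comm, heg, inner_smul_right, hgi]
      rcases eq_or_ne i j with rfl | hij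
      · simp
      · simp [hij, hij.symm]
    | zero => exact inner_zero_left _
    | add x y _ _ hx hy => rw [inner_add_left, hx, hy, add_zero]
    | smul a x _ hx => rw [inner_smul_left, hx, mul_zero]
  -- The Gram determinant gives the square of `normDet`; nonnegativity of both sides allows
  -- comparing squares.
  rw [projectionFactor_eq_normDet, ← sq_eq_sq₀ (LinearMap.normDet_nonneg _)
    (Finset.prod_nonneg fun i _ => hc i)]
  have h := LinearMap.normDet_sq_eq_det_gram
    ((Submodule.span ℝ (Set.range g)).starProjection.toLinearMap ∘ₗ V.subtype) e
  refine h.trans ?_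
  have hgram : Matrix.gram ℝ (fun i =>
      ((Submodule.span ℝ (Set.range g)).starProjection.toLinearMap ∘ₗ V.subtype) (e i)) =
      Matrix.diagonal fun i => c i ^ 2 := by
    ext i j
    rw [Matrix.gram_apply, Matrix.diagonal_apply]
    change ⟪(Submodule.span ℝ (Set.range g)).starProjection (e i : X),
      (Submodule.span ℝ (Set.range g)).starProjection (e j : X)⟫ = _
    rw [hproj, hproj, inner_smul_left, inner_smul_right, hgi]
    rcases eq_or_ne i j with rfl | hij
    · simp [sq]
    · simp [hij]
  rw [hgram, Matrix.det_diagonal, Finset.prod_pow]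

end ProjectionFactor

/-! ### Principal planes, their bivectors and the coordinate subspaces -/

section PrincipalFrames

variable {X : Type*} [NormedAddCommGroup X] [InnerProductSpace ℝ X]
  {V W : Submodule ℝ X} {p : ℕ}
  {e : OrthonormalBasis (Fin p) ℝ V} {f : OrthonormalBasis (Fin p) ℝ W} {θ : Fin p → ℝ}

theorem inner_coe_basis {U : Submodule ℝ X} {ι : Type*} [Fintype ι] [DecidableEq ι]
    (b : OrthonormalBasis ι ℝ U) (i j : ι) : ⟪(b i : X), (b j : X)⟫ = if i = j then 1 else 0 := by
  rw [← Submodule.coe_inner]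
  exact orthonormal_iff_ite.1 b.orthonormal i j

/-- The vector of the `i`-th principal plane completing `f_i` to an orthonormal basis of it. -/
noncomputable def orthoVector (e : OrthonormalBasis (Fin p) ℝ V)
    (f : OrthonormalBasis (Fin p) ℝ W) (θ : Fin p → ℝ) (i : Fin p) : X :=
  (Real.sin (θ i))⁻¹ • ((e i : X) - Real.cos (θ i) • (f i : X))

/-- The basis `(f_1, …, f_p)` with `f_i` replaced by the orthoprincipal vector for `i ∈ s`. -/
noncomputable def replacedFrame (e : OrthonormalBasis (Fin p) ℝ V)
    (f : OrthonormalBasis (Fin p) ℝ W) (θ : Fin p → ℝ) (s : Finset (Fin p)) (i : Fin p) : X :=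
  if i ∈ s then orthoVector e f θ i else (f i : X)

namespace IsAssociatedPrincipal

variable (h : IsAssociatedPrincipal e f θ)

include h

theorem sin_nonneg (i : Fin p) : 0 ≤ Real.sin (θ i) :=
  Real.sin_nonneg_of_nonneg_of_le_pi (h.mem_Icc i).1
    ((h.mem_Icc i).2.trans (by linarith [Real.pi_pos]))

theorem cos_nonneg (i : Fin p) : 0 ≤ Real.cos (θ i) :=
  Real.cos_nonneg_of_mem_Icc ⟨by linarith [(h.mem_Icc i).1, Real.pi_pos], (h.mem_Icc i).2⟩

theorem sin_ne_zero {i : Fin p} (hi : θ i ≠ 0) : Real.sin (θ i) ≠ 0 :=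
  (Real.sin_pos_of_pos_of_lt_pi (lt_of_le_of_ne (h.mem_Icc i).1 hi.symm)
    ((h.mem_Icc i).2.trans_lt (by linarith [Real.pi_pos]))).ne'

theorem coe_eq_coe_of_eq_zero {i : Fin p} (hi : θ i = 0) : (e i : X) = (f i : X) := by
  have h1 := h.inner_eq i i
  rw [if_pos rfl, hi, Real.cos_zero] at h1
  have h2 := inner_coe_basis e i i
  have h3 := inner_coe_basis f i i
  rw [← sub_eq_zero, ← inner_self_eq_zero (𝕜 := ℝ), inner_sub_sub_self (𝕜 := ℝ),
    real_inner_comm (e i : X) (f i : X), h1, h2, h3]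
  simp

/-- The intersection of the subspaces is spanned by the principal vectors with angle zero. -/
theorem inf_eq_span :
    V ⊓ W = Submodule.span ℝ (Set.range fun i : {i // θ i = 0} => (e i : X)) := by
  apply le_antisymm
  · rintro x ⟨hxV, hxW⟩
    have hxe : x = ∑ i, ⟪(e i : X), x⟫ • (e i : X) := by
      have := congrArg (Subtype.val) (e.sum_repr' ⟨x, hxV⟩)
      simpa using this.symm
    have hxf : x = ∑ i, ⟪(f i : X), x⟫ • (f i : X) := by
      have := congrArg (Subtype.val) (f.sum_repr' ⟨x, hxW⟩)
      simpa using this.symm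
    have h1 : ∀ i, ⟪(e i : X), x⟫ = ⟪(f i : X), x⟫ * Real.cos (θ i) := by
      intro i
      conv_lhs => rw [hxf]
      simp [inner_sum, inner_smul_right, h.inner_eq]
    have h2 : ∀ i, ⟪(f i : X), x⟫ = ⟪(e i : X), x⟫ * Real.cos (θ i) := by
      intro i
      conv_lhs => rw [hxe]
      simp [sum_inner, inner_smul_left, real_inner_comm _ (f i : X), h.inner_eq]
    rw [hxe]
    refine Submodule.sum_mem _ fun i _ => ?_
    by_cases hi : θ i = 0
    · exact Submodule.smul_mem _ _ (Submodule.subset_span ⟨⟨i, hi⟩, rfl⟩)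
    -- Combining `h1` and `h2`, the coordinate of `x` along `e i` equals itself times `cos² (θ i)`.
    · have h3 : ⟪(e i : X), x⟫ * Real.sin (θ i) ^ 2 = 0 := by
        rw [Real.sin_sq]
        have := h1 i
        rw [h2 i] at this
        linear_combination this
      have h4 := (mul_eq_zero.1 h3).resolve_right (pow_ne_zero 2 (h.sin_ne_zero hi))
      rw [h4, zero_smul]
      exact Submodule.zero_mem _
  · rw [Submodule.span_le]
    rintro _ ⟨⟨i, hi⟩, rfl⟩
    exact ⟨(e i).2, (congrArg (· ∈ W) (h.coe_eq_coe_of_eq_zero hi)).mpr (f i).2⟩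

theorem finrank_inf :
    Module.finrank ℝ (V ⊓ W : Submodule ℝ X) = (Finset.univ.filter fun i => θ i = 0).card := by
  have hli : LinearIndependent ℝ fun i : {i // θ i = 0} => (e i : X) :=
    (((e.orthonormal.comp_linearIsometry V.subtypeₗᵢ).comp _ Subtype.val_injective :
      Orthonormal ℝ fun i : {i // θ i = 0} => (e i : X))).linearIndependent
  rw [h.inf_eq_span, finrank_span_eq_card hli, Fintype.card_subtype]

/-- As `θ` is nonnegative and monotone, its zeros form an initial segment of `Fin p`, whose length
is the dimension of the intersection. -/
theorem lt_finrank_inf_iff (i : Fin p) :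
    (i : ℕ) < Module.finrank ℝ (V ⊓ W : Submodule ℝ X) ↔ θ i = 0 := by
  rw [h.finrank_inf]
  constructor
  · intro hi
    by_contra h0
    refine absurd hi (not_lt.2 ?_)
    -- If `θ i ≠ 0`, all zeros of `θ` lie strictly below `i`, so there are at most `i` of them.
    rw [← Fin.card_Iio i]
    refine Finset.card_le_card fun j hj => Finset.mem_Iio.2 (lt_of_not_ge fun hij => h0 ?_)
    exact le_antisymm ((h.monotone hij).trans_eq (Finset.mem_filter.1 hj).2) (h.mem_Icc i).1
  · intro h0
    rw [← Nat.succ_le_iff, ← Nat.add_one, ← Fin.card_Iic i]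
    refine Finset.card_le_card fun j hj => Finset.mem_filter.2 ⟨Finset.mem_univ j, ?_⟩
    exact le_antisymm ((h.monotone (Finset.mem_Iic.1 hj)).trans_eq h0) (h.mem_Icc j).1

theorem inner_orthoVector_right (i j : Fin p) :
    ⟪orthoVector e f θ i, (f j : X)⟫ = 0 := by
  rw [orthoVector, inner_smul_left, inner_sub_left, inner_smul_left, h.inner_eq, inner_coe_basis]
  rcases eq_or_ne i j with rfl | hij
  · simp
  · simp [hij]

theorem inner_basis_orthoVector (i j : Fin p) :
    ⟪(e i : X), orthoVector e f θ j⟫ = if i = j then Real.sin (θ i) else 0 := by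
  rw [orthoVector, inner_smul_right, inner_sub_right, inner_smul_right, h.inner_eq,
    inner_coe_basis]
  rcases eq_or_ne i j with rfl | hij
  · rw [if_pos rfl, if_pos rfl, if_pos rfl, ← sq, ← Real.sin_sq]
    -- When the sine vanishes, the convention `0⁻¹ = 0` makes both sides zero, so no condition on
    -- the angle is needed.
    by_cases h0 : Real.sin (θ i) = 0
    · simp [h0]
    · field_simp
  · simp [hij]

theorem inner_orthoVector {j : Fin p} (hj : θ j ≠ 0) (i : Fin p) :
    ⟪orthoVector e f θ j, orthoVector e f θ i⟫ = if j = i then 1 else 0 := by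
  have hs := h.sin_ne_zero hj
  conv_lhs => rw [orthoVector]
  rw [inner_smul_left, inner_sub_left, inner_smul_left, h.inner_basis_orthoVector,
    real_inner_comm, h.inner_orthoVector_right]
  rcases eq_or_ne j i with rfl | hij
  · simp [hs]
  · simp [hij]

theorem coe_eq_add {i : Fin p} (hi : θ i ≠ 0) :
    (e i : X) = Real.cos (θ i) • (f i : X) + Real.sin (θ i) • orthoVector e f θ i := by
  rw [orthoVector, smul_inv_smul₀ (h.sin_ne_zero hi), add_sub_cancel]

theorem orthonormal_replacedFrame {s : Finset (Fin p)} (hs : ∀ i ∈ s, θ i ≠ 0) :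
    Orthonormal ℝ (replacedFrame e f θ s) := by
  rw [orthonormal_iff_ite]
  intro i j
  unfold replacedFrame
  split_ifs with hi hj hij hij hj hij hij
  all_goals first
    | rw [h.inner_orthoVector (hs _ hi)]; simp [hij]
    | (subst hij; contradiction)
    | rw [h.inner_orthoVector_right]
    | rw [real_inner_comm, h.inner_orthoVector_right]
    | rw [inner_coe_basis]; simp [hij]

theorem inner_replacedFrame (s : Finset (Fin p)) (i j : Fin p) :
    ⟪(e i : X), replacedFrame e f θ s j⟫ =
      if i = j then (if i ∈ s then Real.sin (θ i) else Real.cos (θ i)) else 0 := by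
  unfold replacedFrame
  by_cases hj : j ∈ s
  · rw [if_pos hj, h.inner_basis_orthoVector]
    rcases eq_or_ne i j with rfl | hij
    · simp [hj]
    · simp [hij]
  · rw [if_neg hj, h.inner_eq]
    rcases eq_or_ne i j with rfl | hij
    · simp [hj]
    · simp [hij]

theorem principalBivector_of_ne_zero {i : Fin p} (hi : θ i ≠ 0) :
    principalBivector e f i = vec (orthoVector e f θ i) * vec (f i : X) := by
  have hf : ‖(f i : X)‖ = 1 := f.orthonormal.1 i
  have hu : ‖orthoVector e f θ i‖ = 1 := by
    rw [← sq_eq_sq₀ (norm_nonneg _) zero_le_one, ← real_inner_self_eq_norm_sq,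
      h.inner_orthoVector hi, if_pos rfl, one_pow]
  have hw : wedge (vec (e i : X)) (vec (f i : X)) =
      Real.sin (θ i) • (vec (orthoVector e f θ i) * vec (f i : X)) := by
    rw [h.coe_eq_add hi, wedge_add_smul (h.inner_orthoVector_right i i)]
  rw [principalBivector, if_neg (mt (h.lt_finrank_inf_iff i).1 hi), hw,
    mnorm_smul_vec_mul_vec hu hf (h.sin_nonneg i), inv_smul_smul₀ (h.sin_ne_zero hi)]

theorem principalBivector_mul_vec {i : Fin p} (hi : θ i ≠ 0) :
    principalBivector e f i * vec (f i : X) = vec (orthoVector e f θ i) := by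
  rw [h.principalBivector_of_ne_zero hi, mul_assoc, vec_mul_self, inner_coe_basis, if_pos rfl,
    map_one, mul_one]

/-- With `u` the unit vector `orthoVector e f θ i`: `I (u f) = -(I f) u = -u u = -1`. -/
theorem principalBivector_mul_self {i : Fin p} (hi : θ i ≠ 0) :
    principalBivector e f i * principalBivector e f i = -1 := by
  nth_rw 2 [h.principalBivector_of_ne_zero hi]
  rw [vec_mul_vec_of_orthogonal (h.inner_orthoVector_right i i), mul_neg, ← mul_assoc,
    h.principalBivector_mul_vec hi, vec_mul_self, h.inner_orthoVector hi, if_pos rfl, map_one]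

theorem commute_principalBivector_vec {i j : Fin p} (hi : θ i ≠ 0) (hij : i ≠ j) :
    Commute (principalBivector e f i) (vec (f j : X)) := by
  rw [h.principalBivector_of_ne_zero hi]
  exact commute_vec_mul_vec (h.inner_orthoVector_right i j) (by rw [inner_coe_basis, if_neg hij])

theorem commute_principalBivector_vec_orthoVector {i j : Fin p} (hi : θ i ≠ 0) (hij : i ≠ j) :
    Commute (principalBivector e f i) (vec (orthoVector e f θ j)) := by
  rw [h.principalBivector_of_ne_zero hi]
  exact commute_vec_mul_vec (by rw [h.inner_orthoVector hi, if_neg hij])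
    (by rw [real_inner_comm, h.inner_orthoVector_right])

theorem commute_principalBivector {i j : Fin p} (hi : θ i ≠ 0) (hj : θ j ≠ 0) :
    Commute (principalBivector e f i) (principalBivector e f j) := by
  rcases eq_or_ne i j with rfl | hij
  · exact Commute.refl _
  · rw [h.principalBivector_of_ne_zero hj]
    exact (h.commute_principalBivector_vec_orthoVector hi hij).mul_right
      (h.commute_principalBivector_vec hi hij)

/-- The product `I_s F` replaces the factors `f_i` of `F` with `i ∈ s` by the orthoprincipal
vectors. -/
theorem bivectorProd_mul_basisProd {s : Finset (Fin p)} (hs : ∀ i ∈ s, θ i ≠ 0) :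
    bivectorProd e f s * basisProd f =
      (List.ofFn fun i => vec (replacedFrame e f θ s i)).prod := by
  induction s using Finset.induction_on_min with
  | empty => simp [bivectorProd, basisProd, replacedFrame]
  | insert a s ha ih =>
    have has : a ∉ s := fun h => lt_irrefl _ (ha a h)
    have hθ : θ a ≠ 0 := hs a (Finset.mem_insert_self a s)
    have hframe : ∀ j ∉ s, replacedFrame e f θ s j = f j := fun j hj => if_neg hj
    have hI : bivectorProd e f (insert a s) = principalBivector e f a * bivectorProd e f s := by
      rw [bivectorProd, Finset.sort_insert (r := (· ≤ ·)) (fun b hb => (ha b hb).le) has,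
        List.map_cons, List.prod_cons, bivectorProd]
    rw [hI, mul_assoc, ih fun i hi => hs i (Finset.mem_insert_of_mem hi),
      mul_prod_ofFn_eq_update _ a]
    · congr 2
      ext j
      rcases eq_or_ne j a with rfl | hja
      · rw [Function.update_self, hframe j has, h.principalBivector_mul_vec hθ, replacedFrame,
          if_pos (Finset.mem_insert_self j s)]
      · rw [Function.update_of_ne hja]
        simp only [replacedFrame, Finset.mem_insert, hja, false_or]
    -- Since `a` lies below all of `s`, the factors before position `a` are still the `f j`, which
    -- commute with `I_a`.
    · intro j hj
      rw [hframe j fun hjs => lt_asymm hj (ha j hjs)]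
      exact h.commute_principalBivector_vec hθ hj.ne'

theorem coordSubspace_eq_span {s : Finset (Fin p)} (hs : ∀ i ∈ s, θ i ≠ 0) :
    coordSubspace e f s = Submodule.span ℝ (Set.range (replacedFrame e f θ s)) := by
  have ho := h.orthonormal_replacedFrame hs
  rw [coordSubspace, h.bivectorProd_mul_basisProd hs, prod_vec_eq_blade _ fun i j hij => ho.2 hij,
    bladeSpace_blade (blade_ne_zero ho.linearIndependent)]

/-- The comparison takes place in the geometric algebra because `orthoprincipal` is defined there as
a product, not as a vector of `X`. -/
theorem map_vec_coordSubspace {s : Finset (Fin p)} (hs : ∀ i ∈ s, θ i ≠ 0) :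
    (coordSubspace e f s).map vec = Submodule.span ℝ (Set.range fun i =>
      if i ∈ s then orthoprincipal e f i else vec (f i : X)) := by
  rw [h.coordSubspace_eq_span hs, Submodule.map_span, ← Set.range_comp]
  congr 2
  ext i
  rw [Function.comp_apply, replacedFrame]
  split_ifs with hi
  · rw [orthoprincipal, h.principalBivector_mul_vec (hs i hi)]
  · rfl

theorem multiIndices_eq_powerset :
    multiIndices (Module.finrank ℝ (V ⊓ W : Submodule ℝ X)) p =
      (Finset.univ.filter fun i => θ i ≠ 0).powerset := by
  ext s
  simp only [multiIndices, Finset.mem_filter, Finset.mem_univ, true_and, Finset.mem_powerset,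
    Finset.subset_iff, ← not_lt, h.lt_finrank_inf_iff, ne_eq]

theorem mexp_angleBivector [FiniteDimensional ℝ X] :
    mexp (angleBivector e f θ) =
      ∑ s ∈ multiIndices (Module.finrank ℝ (V ⊓ W : Submodule ℝ X)) p,
        (∏ i, if i ∈ s then Real.sin (θ i) else Real.cos (θ i)) • bivectorProd e f s := by
  have hsum : angleBivector e f θ =
      ∑ i ∈ Finset.univ.filter fun i => θ i ≠ 0, θ i • principalBivector e f i := by
    refine (Finset.sum_filter_of_ne (p := fun i => θ i ≠ 0) fun i _ hi hi0 => hi ?_).symm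
    rw [hi0, zero_smul]
  rw [hsum, mexp_sum_smul (principalBivector e f) θ _
    (fun i hi => h.principalBivector_mul_self (Finset.mem_filter.1 hi).2)
    fun i hi j hj => h.commute_principalBivector (Finset.mem_filter.1 hi).2
      (Finset.mem_filter.1 hj).2, h.multiIndices_eq_powerset]
  refine Finset.sum_congr rfl fun s hs => ?_
  rw [bivectorProd]
  congr 1
  -- An index with zero angle is not in `s`, so its factor is `cos 0 = 1` and the product may run
  -- over all indices.
  refine Finset.prod_filter_of_ne (p := fun i => θ i ≠ 0) fun i _ hi hi0 => hi ?_
  have his : i ∉ s := fun his => (Finset.mem_filter.1 (Finset.mem_powerset.1 hs his)).2 hi0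
  rw [if_neg his, hi0, Real.cos_zero]

theorem projectionFactor_coordSubspace [FiniteDimensional ℝ X] [MeasurableSpace X] [BorelSpace X]
    {s : Finset (Fin p)} (hs : ∀ i ∈ s, θ i ≠ 0) :
    projectionFactor V (coordSubspace e f s) =
      ∏ i, if i ∈ s then Real.sin (θ i) else Real.cos (θ i) := by
  rw [h.coordSubspace_eq_span hs]
  refine projectionFactor_span_of_inner_eq_diagonal e (h.orthonormal_replacedFrame hs)
    (fun i => ?_) (h.inner_replacedFrame s)
  split_ifs
  exacts [h.sin_nonneg i, h.cos_nonneg i]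

theorem cos_asymmetricAngle_coordSubspace [FiniteDimensional ℝ X] [MeasurableSpace X]
    [BorelSpace X] {s : Finset (Fin p)} (hs : ∀ i ∈ s, θ i ≠ 0) :
    Real.cos (asymmetricAngle V (coordSubspace e f s)) =
      projectionFactor V (coordSubspace e f s) := by
  have hnn : ∀ i, 0 ≤ if i ∈ s then Real.sin (θ i) else Real.cos (θ i) := by
    intro i
    split_ifs
    exacts [h.sin_nonneg i, h.cos_nonneg i]
  rw [asymmetricAngle, h.projectionFactor_coordSubspace hs]
  -- `Real.arccos` truncates outside `[-1, 1]`, so the product of sines and cosines must be bounded.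
  refine Real.cos_arccos ?_ ?_
  · exact neg_one_lt_zero.le.trans (Finset.prod_nonneg fun i _ => hnn i)
  · refine Finset.prod_le_one (fun i _ => hnn i) fun i _ => ?_
    split_ifs
    exacts [Real.sin_le_one _, Real.cos_le_one _]

end IsAssociatedPrincipal

end PrincipalFrames

end BladeAngle

open BladeAngle in
theorem theorem3p18 {X : Type*} [NormedAddCommGroup X] [InnerProductSpace ℝ X]
    [FiniteDimensional ℝ X] [MeasurableSpace X] [BorelSpace X]
    (V W : Submodule ℝ X) (p d : ℕ) (hd : d = Module.finrank ℝ (V ⊓ W : Submodule ℝ X))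
    (e : OrthonormalBasis (Fin p) ℝ V) (f : OrthonormalBasis (Fin p) ℝ W) (θ : Fin p → ℝ)
    (h : IsAssociatedPrincipal e f θ) :
    (mexp (angleBivector e f θ) =
      ∑ s ∈ multiIndices d p,
        Real.cos (asymmetricAngle V (coordSubspace e f s)) • bivectorProd e f s) ∧
    (mexp (angleBivector e f θ) =
      ∑ s ∈ multiIndices d p,
        projectionFactor V (coordSubspace e f s) • bivectorProd e f s) ∧
    ∀ s ∈ multiIndices d p,
      (coordSubspace e f s).map vec =
        Submodule.span ℝ (Set.range fun i =>
          if i ∈ s then orthoprincipal e f i else vec (f i : X)) := by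
  subst hd
  have hne : ∀ s ∈ multiIndices (Module.finrank ℝ (V ⊓ W : Submodule ℝ X)) p,
      ∀ i ∈ s, θ i ≠ 0 := by
    intro s hs i hi
    rw [h.multiIndices_eq_powerset, Finset.mem_powerset] at hs
    exact (Finset.mem_filter.1 (hs hi)).2
  refine ⟨?_, ?_, fun s hs => h.map_vec_coordSubspace (hne s hs)⟩
  · rw [h.mexp_angleBivector]
    refine Finset.sum_congr rfl fun s hs => ?_
    rw [h.cos_asymmetricAngle_coordSubspace (hne s hs),
      h.projectionFactor_coordSubspace (hne s hs)]
  · rw [h.mexp_angleBivector]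
    refine Finset.sum_congr rfl fun s hs => ?_
    rw [h.projectionFactor_coordSubspace (hne s hs)]
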